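/- Let $M$ (men) and $W$ (women) be finite sets. Each man $m$ has a sincere strict total order on $W\cup\{m\}$ and each woman $w$ a sincere strict total order on $M\cup\{w\}$, where ranking oneself means being unmatched; together these form the sincere profile $\Pi$. Each individual $y$ submits an order $P_y$ of the same kind, not necessarily the sincere one, and the man-proposing Gale–Shapley algorithm (with the proposals executed in any order) applied to the submitted profile $P$ selects a matching $r(P)$. A submitted profile $P$ is an equilibrium if no individual $y$ can obtain a partner that is sincerely strictly preferred to $r(P)(y)$ by submitting a different order while all others keep theirs. Let $K$ be the Kendall tau distance (the number of unordered pairs that two orders rank oppositely). An equilibrium $P$ is minimally dishonest if, for each individual $y$, submitting any order $P_y'$ with $K(P_y',\Pi_y)<K(P_y,\Pi_y)$ instead of $P_y$ gives $y$ a partner that is sincerely strictly worse than $r(P)(y)$. It is locally minimally dishonest if this is required only for those orders $P_y'$ that are obtained from $P_y$ by swapping two entries. Then for every sincere profile $\Pi$: (i) a minimally dishonest equilibrium exists, and a locally minimally dishonest equilibrium exists; (ii) for every minimally dishonest equilibrium $P$, and more generally for every locally minimally dishonest equilibrium $P$, the matching $r(P)$ is the woman-optimal stable matching with respect to $\Pi$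 (it is stable with respect to $\Pi$, and no woman sincerely prefers any matching that is stable with respect to $\Pi$ to it), and every man is completely honest, i.e. $P_m=\Pi_m$ for all $m\in M$. -/

import Mathlib

namespace StableMatching

/-- A preference list over `α`: a strict total ordering of the finite type `α`, given by the
position of every alternative (position `0` is the favourite). -/
abbrev PrefList (α : Type*) [Fintype α] := α ≃ Fin (Fintype.card α)

/-- `Prefers p x y`: with list `p`, alternative `x` is strictly preferred to `y`. -/
abbrev Prefers {α : Type*} [Fintype α] (p : PrefList α) (x y : α) : Prop := p x < p y

/-- The Kendall tau distance. An unordered pair `{i, j}` on which the two lists disagree is counted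
exactly once, through the ordered pair `(i, j)` with `i` before `j` in `p` and after `j` in `q`. -/
def kendallTau {α : Type*} [Fintype α] (p q : PrefList α) : ℕ :=
  (Finset.univ.filter fun x : α × α => Prefers p x.1 x.2 ∧ Prefers q x.2 x.1).card

open Classical in
/-- The list obtained from `p` by swapping the entries `a` and `b`. -/
noncomputable def swapEntries {α : Type*} [Fintype α] (p : PrefList α) (a b : α) : PrefList α :=
  (Equiv.swap a b).trans p

/-- A preference profile. A man ranks `Option W`, where `some w` is the woman `w` and `none` stands
for himself (being unmatched); symmetrically for the women. -/
structure Profile (M W : Type*) [Fintype M] [Fintype W] where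
  men : M → PrefList (Option W)
  women : W → PrefList (Option M)

open Classical in
/-- The profile in which man `m` submits `p` and everybody else submits as in `P`. -/
noncomputable def Profile.updateMan {M W : Type*} [Fintype M] [Fintype W] (P : Profile M W)
    (m : M) (p : PrefList (Option W)) : Profile M W :=
  ⟨Function.update P.men m p, P.women⟩

open Classical in
/-- The profile in which woman `w` submits `p` and everybody else submits as in `P`. -/
noncomputable def Profile.updateWoman {M W : Type*} [Fintype M] [Fintype W] (P : Profile M W)
    (w : W) (p : PrefList (Option M)) : Profile M W :=
  ⟨P.men, Function.update P.women w p⟩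

/-- A matching; `none` means self-matched (unmatched). -/
structure Matching (M W : Type*) where
  wife : M → Option W
  husband : W → Option M
  wife_eq_iff : ∀ m w, wife m = some w ↔ husband w = some m

/-- The matching in which everybody is unmatched. -/
def Matching.empty (M W : Type*) : Matching M W where
  wife := fun _ => none
  husband := fun _ => none
  wife_eq_iff := by simp

open Classical in
/-- Match `m` with `w`; previous partners of `m` or `w` become unmatched. -/
noncomputable def Matching.marry {M W : Type*} (μ : Matching M W) (m : M) (w : W) :
    Matching M W where
  wife := fun m' => if m' = m then some w else if μ.wife m' = some w then none else μ.wife m'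
  husband := fun w' =>
    if w' = w then some m else if μ.husband w' = some m then none else μ.husband w'
  wife_eq_iff := by
    intro m' w'
    have h := μ.wife_eq_iff
    grind

/-- `μ` is individually rational: nobody strictly prefers being unmatched to the own partner. -/
def IndividuallyRational {M W : Type*} [Fintype M] [Fintype W] (P : Profile M W)
    (μ : Matching M W) : Prop :=
  (∀ m, μ.wife m = none ∨ Prefers (P.men m) (μ.wife m) none) ∧
    (∀ w, μ.husband w = none ∨ Prefers (P.women w) (μ.husband w) none)

/-- `m` and `w` strictly prefer each other to their partners in `μ`. -/
def Blocks {M W : Type*} [Fintype M] [Fintype W] (P : Profile M W) (μ : Matching M W)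
    (m : M) (w : W) : Prop :=
  Prefers (P.men m) (some w) (μ.wife m) ∧ Prefers (P.women w) (some m) (μ.husband w)

/-- Stability of `μ` with respect to `P`. -/
def IsStable {M W : Type*} [Fintype M] [Fintype W] (P : Profile M W) (μ : Matching M W) : Prop :=
  IndividuallyRational P μ ∧ ∀ m w, ¬ Blocks P μ m w

/-- `μ` is the woman-optimal stable matching for `P`: it is stable, and no woman strictly prefers
any stable matching to it. -/
def IsWomanOptimal {M W : Type*} [Fintype M] [Fintype W] (P : Profile M W)
    (μ : Matching M W) : Prop :=
  IsStable P μ ∧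
    ∀ ν, IsStable P ν → ∀ w, ¬ Prefers (P.women w) (ν.husband w) (μ.husband w)

/-! The man-proposing Gale-Shapley algorithm. -/

/-- A state of the algorithm: the current matching and the proposals made so far. -/
structure GSState (M W : Type*) where
  matching : Matching M W
  proposed : Finset (M × W)

/-- The next proposal may be from `m` to `w`: `m` is unmatched, is willing to match `w`, and `w` is
the woman he likes best among those he has not proposed to. (He is unmatched, so these are exactly
the women that have not rejected him.) -/
def CanPropose {M W : Type*} [Fintype M] [Fintype W] (P : Profile M W) (s : GSState M W)
    (m : M) (w : W) : Prop :=
  s.matching.wife m = none ∧ (m, w) ∉ s.proposed ∧ Prefers (P.men m) (some w) none ∧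
    ∀ w', (m, w') ∉ s.proposed → ¬ Prefers (P.men m) (some w') (some w)

open Classical in
/-- Execution of the proposal from `m` to `w`: if `w` prefers her current match (possibly herself)
she rejects `m`, otherwise she rejects her current match and is matched with `m`. -/
noncomputable def gsStep {M W : Type*} [Fintype M] [Fintype W] (P : Profile M W)
    (s : GSState M W) (m : M) (w : W) : GSState M W where
  matching :=
    if Prefers (P.women w) (s.matching.husband w) (some m) then s.matching
    else s.matching.marry m w
  proposed := insert (m, w) s.proposed

/-- A rule that selects which of the possible proposals is executed next; the description of the
algorithm leaves this choice open. -/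
abbrev ProposalRule (M W : Type*) [Fintype M] [Fintype W] :=
  ∀ (P : Profile M W) (s : GSState M W), (∃ x : M × W, CanPropose P s x.1 x.2) →
    {x : M × W // CanPropose P s x.1 x.2}

open Classical in
/-- Run the algorithm from state `s` until no proposal is possible. -/
noncomputable def gsRun {M W : Type*} [Fintype M] [Fintype W] (rule : ProposalRule M W)
    (P : Profile M W) (s : GSState M W) : Matching M W :=
  if h : ∃ x : M × W, CanPropose P s x.1 x.2 then
    gsRun rule P (gsStep P s (rule P s h).1.1 (rule P s h).1.2)
  else s.matching
termination_by (s.proposedᶜ).card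
decreasing_by
  apply Finset.card_lt_card
  rw [Finset.compl_ssubset_compl]
  exact Finset.ssubset_insert (rule P s h).2.2.1

/-- The man-proposing Gale-Shapley mechanism: everybody starts unmatched. -/
noncomputable def galeShapley {M W : Type*} [Fintype M] [Fintype W] (rule : ProposalRule M W)
    (P : Profile M W) : Matching M W :=
  gsRun rule P ⟨Matching.empty M W, ∅⟩

/-! The strategic game with a deterministic mechanism `r`, sincere profile `S` and submitted
profile `P`. -/

/-- `P` is a pure Nash equilibrium: nobody can obtain a sincerely strictly preferred partner by
submitting another list. -/
def IsNash {M W : Type*} [Fintype M] [Fintype W] (r : Profile M W → Matching M W)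
    (S P : Profile M W) : Prop :=
  (∀ m p, ¬ Prefers (S.men m) ((r (P.updateMan m p)).wife m) ((r P).wife m)) ∧
    (∀ w p, ¬ Prefers (S.women w) ((r (P.updateWoman w p)).husband w) ((r P).husband w))

/-- Man `m` is minimally dishonest: every more honest list gives him a strictly worse partner. -/
def ManMinDishonest {M W : Type*} [Fintype M] [Fintype W] (r : Profile M W → Matching M W)
    (S P : Profile M W) (m : M) : Prop :=
  ∀ p, kendallTau p (S.men m) < kendallTau (P.men m) (S.men m) →
    Prefers (S.men m) ((r P).wife m) ((r (P.updateMan m p)).wife m)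

/-- Woman `w` is minimally dishonest. -/
def WomanMinDishonest {M W : Type*} [Fintype M] [Fintype W] (r : Profile M W → Matching M W)
    (S P : Profile M W) (w : W) : Prop :=
  ∀ p, kendallTau p (S.women w) < kendallTau (P.women w) (S.women w) →
    Prefers (S.women w) ((r P).husband w) ((r (P.updateWoman w p)).husband w)

/-- Man `m` is locally minimally dishonest: the same requirement, but only for the lists obtained
from his submitted list by swapping two entries. -/
def ManLocallyMinDishonest {M W : Type*} [Fintype M] [Fintype W]
    (r : Profile M W → Matching M W) (S P : Profile M W) (m : M) : Prop :=
  ∀ a b, kendallTau (swapEntries (P.men m) a b) (S.men m) < kendallTau (P.men m) (S.men m) →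
    Prefers (S.men m) ((r P).wife m) ((r (P.updateMan m (swapEntries (P.men m) a b))).wife m)

/-- Woman `w` is locally minimally dishonest. -/
def WomanLocallyMinDishonest {M W : Type*} [Fintype M] [Fintype W]
    (r : Profile M W → Matching M W) (S P : Profile M W) (w : W) : Prop :=
  ∀ a b,
    kendallTau (swapEntries (P.women w) a b) (S.women w) < kendallTau (P.women w) (S.women w) →
    Prefers (S.women w) ((r P).husband w)
      ((r (P.updateWoman w (swapEntries (P.women w) a b))).husband w)

/-- `P` is a minimally dishonest equilibrium for the sincere profile `S`. -/
def IsMinDishonestEq {M W : Type*} [Fintype M] [Fintype W] (r : Profile M W → Matching M W)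
    (S P : Profile M W) : Prop :=
  IsNash r S P ∧ (∀ m, ManMinDishonest r S P m) ∧ (∀ w, WomanMinDishonest r S P w)

/-- `P` is a locally minimally dishonest equilibrium for the sincere profile `S`. -/
def IsLocallyMinDishonestEq {M W : Type*} [Fintype M] [Fintype W]
    (r : Profile M W → Matching M W) (S P : Profile M W) : Prop :=
  IsNash r S P ∧ (∀ m, ManLocallyMinDishonest r S P m) ∧
    (∀ w, WomanLocallyMinDishonest r S P w)

end StableMatching

namespace StableMatching

variable {M W : Type*}

/-! Three classical facts carry the argument: the algorithm selects the stable matching best for all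
men and worst for all women (`galeShapley_spec`, `IsStable.husband_le_of_wife_le`), the same agents
are matched in all stable matchings (`IsStable.rural`), and men cannot gain by lying
(`galeShapley_strategyproof`).

Characterization: undoing an adjacent inversion in a man's list brings him closer to the truth and
never hurts him, so locally minimally dishonest men are honest. A woman can obtain any man who
prefers her to his partner (`exists_report_of_prefers`), hence a Nash outcome is sincerely stable.
Local minimality leaves women no adjacent inversion whose sincerely better entry is at least as good
as their outcome (`no_adjacent_inversion`). If a woman got less than in the woman-optimal matching
ω, she could accept only her ω-partner: ω would be stable for that profile, and by equality of the
matched sets she would get him, against Nash.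

Existence: consider profiles with honest men, outcome ω, and women honest down to their ω-partners.
All are equilibria (`SupportsOutcome.isNash`), and one of least total dishonesty is minimally
dishonest, because a more honest report that costs a woman nothing can be repaired to stay in the
class (`SupportsOutcome.raiseAbove`). -/

lemma Matching.ext_husband {μ ν : Matching M W} (h : ∀ w, μ.husband w = ν.husband w) : μ = ν := by
  have hw : μ.wife = ν.wife := by
    funext m
    refine Option.ext fun w => ?_
    rw [μ.wife_eq_iff, ν.wife_eq_iff, h]
  have hh : μ.husband = ν.husband := funext h
  cases μ; cases ν; cases hw; cases hh; rfl

lemma Matching.ext_wife {μ ν : Matching M W} (h : ∀ m, μ.wife m = ν.wife m) : μ = ν := by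
  refine Matching.ext_husband fun w => ?_
  refine Option.ext fun m => ?_
  rw [← μ.wife_eq_iff, ← ν.wife_eq_iff, h]

lemma marry_husband_of_unmatched {μ : Matching M W} {m : M} {w : W} (h : μ.wife m = none) (w' : W)
    (hw : w' ≠ w) : (μ.marry m w).husband w' = μ.husband w' := by
  have : μ.husband w' ≠ some m := by rw [Ne, ← μ.wife_eq_iff, h]; simp
  simp [Matching.marry, hw, this]

lemma marry_husband_self (μ : Matching M W) (m : M) (w : W) :
    (μ.marry m w).husband w = some m := by
  simp [Matching.marry]

variable [Fintype M] [Fintype W]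

/-- `t` is available to `w` at `μ`: it is being unmatched, or a man who prefers `w` to his wife. -/
def Wants (P : Profile M W) (μ : Matching M W) (w : W) (t : Option M) : Prop :=
  ∀ m, t = some m → Prefers (P.men m) (some w) (μ.wife m)

lemma prefers_or_eq_iff {α : Type*} [Fintype α] (p : PrefList α) (x y : α) :
    (x = y ∨ Prefers p x y) ↔ p x ≤ p y := by
  rw [le_iff_eq_or_lt, p.injective.eq_iff]

lemma isStable_iff (P : Profile M W) (μ : Matching M W) :
    IsStable P μ ↔ (∀ m, P.men m (μ.wife m) ≤ P.men m none) ∧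
      ∀ w t, Wants P μ w t → P.women w (μ.husband w) ≤ P.women w t := by
  simp only [IsStable, IndividuallyRational, prefers_or_eq_iff, Blocks, Wants]
  constructor
  · rintro ⟨⟨h1, h2⟩, h3⟩
    refine ⟨h1, fun w t ht => ?_⟩
    rcases t with _ | m
    · exact h2 w
    · by_contra! h
      exact h3 m w ⟨ht m rfl, h⟩
  · rintro ⟨h1, h2⟩
    refine ⟨⟨h1, fun w => h2 w none (by simp)⟩, fun m w h => ?_⟩
    exact absurd h.2 (not_lt.2 (h2 w (some m) (by rintro m' ⟨⟩; exact h.1)))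

/-! ### Invariants and man-optimality of the algorithm -/

/-- The facts preserved by the steps of the man-proposing algorithm. -/
structure GSInvariant (P : Profile M W) (s : GSState M W) : Prop where
  proposed_wife : ∀ m w, s.matching.wife m = some w → (m, w) ∈ s.proposed
  acceptable : ∀ m w, (m, w) ∈ s.proposed → P.men m (some w) < P.men m none
  husband_le : ∀ m w, (m, w) ∈ s.proposed →
    P.women w (s.matching.husband w) ≤ P.women w (some m)
  husband_le_none : ∀ w, P.women w (s.matching.husband w) ≤ P.women w none
  upward : ∀ m w w', (m, w) ∈ s.proposed → P.men m (some w') < P.men m (some w) →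
    (m, w') ∈ s.proposed

open Classical in
lemma GSInvariant.step {P : Profile M W} {s : GSState M W} (hs : GSInvariant P s) {m : M} {w : W}
    (h : CanPropose P s m w) : GSInvariant P (gsStep P s m w) := by
  obtain ⟨hun, hnew, hacc, hbest⟩ := h
  have hup : ∀ m' v v', (m', v) ∈ insert (m, w) s.proposed →
      P.men m' (some v') < P.men m' (some v) → (m', v') ∈ insert (m, w) s.proposed := by
    intro m' v v' hv hlt
    rw [Finset.mem_insert] at hv ⊢
    rcases hv with hv | hv
    · cases hv
      right
      by_contra hc
      exact hbest v' hc hlt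
    · exact Or.inr (hs.upward _ _ _ hv hlt)
  have hac : ∀ m' v, (m', v) ∈ insert (m, w) s.proposed →
      P.men m' (some v) < P.men m' none := by
    intro m' v hv
    rcases Finset.mem_insert.1 hv with hv | hv
    · cases hv; exact hacc
    · exact hs.acceptable _ _ hv
  by_cases hrej : Prefers (P.women w) (s.matching.husband w) (some m)
  · refine ⟨?_, hac, ?_, ?_, hup⟩ <;> simp only [gsStep, if_pos hrej]
    · intro m' v hv
      exact Finset.mem_insert_of_mem (hs.proposed_wife _ _ hv)
    · intro m' v hv
      rcases Finset.mem_insert.1 hv with hv | hv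
      · cases hv; exact hrej.le
      · exact hs.husband_le _ _ hv
    · exact hs.husband_le_none
  · refine ⟨?_, hac, ?_, ?_, hup⟩ <;> simp only [gsStep, if_neg hrej]
    · intro m' v hv
      rw [Matching.wife_eq_iff] at hv
      by_cases hvw : v = w
      · subst hvw
        rw [marry_husband_self] at hv
        cases hv
        exact Finset.mem_insert_self _ _
      · rw [marry_husband_of_unmatched hun _ hvw, ← Matching.wife_eq_iff] at hv
        exact Finset.mem_insert_of_mem (hs.proposed_wife _ _ hv)
    · intro m' v hv
      by_cases hvw : v = w
      · subst hvw
        rw [marry_husband_self]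
        rcases Finset.mem_insert.1 hv with hv | hv
        · cases hv; exact le_rfl
        · exact (not_lt.1 hrej).trans (hs.husband_le _ _ hv)
      · rw [marry_husband_of_unmatched hun _ hvw]
        rcases Finset.mem_insert.1 hv with hv | hv
        · cases hv; exact absurd rfl hvw
        · exact hs.husband_le _ _ hv
    · intro v
      by_cases hvw : v = w
      · subst hvw
        rw [marry_husband_self]
        exact (not_lt.1 hrej).trans (hs.husband_le_none v)
      · rw [marry_husband_of_unmatched hun _ hvw]
        exact hs.husband_le_none v

/-- No proposal that `ν` executes has been rejected. -/
def Unrejected (ν : Matching M W) (s : GSState M W) : Prop :=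
  ∀ m w, (m, w) ∈ s.proposed → ν.wife m = some w → s.matching.wife m = some w

/-- No pair with a woman who is matched in `ν` blocks `ν`, and no such woman prefers to be
unmatched. -/
def NearlyStable (P : Profile M W) (ν : Matching M W) : Prop :=
  ∀ w t, Wants P ν w t → ν.husband w = none ∨ P.women w (ν.husband w) ≤ P.women w t

-- The first-rejection argument: a man for whom a woman gives up her ν-partner has not been rejected
-- by his own ν-partner, so he prefers this woman to his ν-partner, and the pair would block ν. Only
-- women matched in ν occur, so `NearlyStable` suffices in place of stability.
open Classical in
lemma Unrejected.step {P : Profile M W} {ν : Matching M W} (hν : NearlyStable P ν)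
    {s : GSState M W} (hs : GSInvariant P s) (hu : Unrejected ν s) {m : M} {w : W}
    (h : CanPropose P s m w) : Unrejected ν (gsStep P s m w) := by
  obtain ⟨hun, hnew, hacc, hbest⟩ := h
  intro m' v hv hm'
  have hν' := (ν.wife_eq_iff _ _).1 hm'
  by_cases hrej : Prefers (P.women w) (s.matching.husband w) (some m)
  · simp only [gsStep, if_pos hrej] at hv ⊢
    rcases Finset.mem_insert.1 hv with hv | hv
    · cases hv
      have key : Wants P ν w (s.matching.husband w) := by
        intro m1 hm1
        have hw1 := (s.matching.wife_eq_iff _ _).2 hm1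
        have hp1 := hs.proposed_wife _ _ hw1
        have hne : ν.wife m1 ≠ some w := by
          rw [Ne, ν.wife_eq_iff, hν']
          rintro ⟨⟩
          exact hnew hp1
        by_contra hc
        -- Had `m1` liked his ν-wife better than `w`, he would have proposed to her earlier and,
        -- being unrejected, would still be with her.
        rcases hw : ν.wife m1 with _ | w1
        · rw [hw] at hc; exact hc (hs.acceptable _ _ hp1)
        · have hlt : P.men m1 (some w1) < P.men m1 (some w) := by
            rw [hw] at hc hne
            exact lt_of_le_of_ne (not_lt.1 hc) fun h => hne ((P.men m1).injective h)
          have := hu _ _ (hs.upward _ _ _ hp1 hlt) hw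
          rw [hw1] at this
          exact hne (by rw [hw, this])
      rcases hν w _ key with h | h
      · rw [hν'] at h; cases h
      · rw [hν'] at h; exact absurd hrej (not_lt.2 h)
    · exact hu _ _ hv hm'
  · simp only [gsStep, if_neg hrej] at hv ⊢
    rw [Matching.wife_eq_iff]
    rcases Finset.mem_insert.1 hv with hv | hv2
    · cases hv
      exact marry_husband_self _ _ _
    · have h1 := (s.matching.wife_eq_iff _ _).1 (hu _ _ hv2 hm')
      by_cases hvw : v = w
      · exfalso
        subst hvw
        rw [h1] at hrej
        have hne : m' ≠ m := by rintro rfl; exact hnew hv2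
        have key : Wants P ν v (some m) := by
          rintro m1 ⟨⟩
          by_contra hc
          rcases hw : ν.wife m with _ | w1
          · rw [hw] at hc; exact hc hacc
          · have hw1 : w1 ≠ v := by
              rintro rfl
              rw [ν.wife_eq_iff, hν'] at hw
              exact hne (Option.some.inj hw)
            have hlt : P.men m (some w1) < P.men m (some v) := by
              rw [hw] at hc
              exact lt_of_le_of_ne (not_lt.1 hc)
                fun h => hw1 (Option.some.inj ((P.men m).injective h))
            have hp : (m, w1) ∈ s.proposed := by
              by_contra hp
              exact hbest _ hp hlt
            have := hu _ _ hp hw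
            rw [hun] at this
            cases this
        rcases hν v _ key with h | h
        · rw [hν'] at h; cases h
        · rw [hν'] at h
          exact hrej (lt_of_le_of_ne h
            fun h => hne (Option.some.inj ((P.women v).injective h)))
      · rw [marry_husband_of_unmatched hun _ hvw, h1]

/-- The final state is kept, not only its matching, because optimality and stability are read off
the set of proposals made. -/
lemma gsRun_spec (rule : ProposalRule M W) (P : Profile M W) (s : GSState M W)
    (hs : GSInvariant P s) :
    ∃ s', s'.matching = gsRun rule P s ∧ GSInvariant P s' ∧
      (∀ ν, NearlyStable P ν → Unrejected ν s → Unrejected ν s') ∧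
      ¬ ∃ x : M × W, CanPropose P s' x.1 x.2 := by
  induction s using gsRun.induct rule P with
  | case1 s h ih =>
    obtain ⟨s', h1, h2, h3, h4⟩ := ih (hs.step (rule P s h).2)
    refine ⟨s', ?_, h2, fun ν hν hu => h3 ν hν (hu.step hν hs (rule P s h).2), h4⟩
    rw [h1]
    conv_rhs => rw [gsRun]
    rw [dif_pos h]
  | case2 s h =>
    refine ⟨s, ?_, hs, fun ν _ hu => hu, h⟩
    rw [gsRun, dif_neg h]

lemma proposed_of_not_canPropose {P : Profile M W} {s : GSState M W} (hs : GSInvariant P s)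
    (h : ¬ ∃ x : M × W, CanPropose P s x.1 x.2) {m : M} {w : W}
    (hw : P.men m (some w) < P.men m (s.matching.wife m)) : (m, w) ∈ s.proposed := by
  classical
  rcases hm : s.matching.wife m with _ | v
  · by_contra hc
    rw [hm] at hw
    obtain ⟨b, hb, hmin⟩ := Finset.exists_min_image
      (Finset.univ.filter fun v => (m, v) ∉ s.proposed) (fun v => P.men m (some v))
      ⟨w, by simpa using hc⟩
    simp only [Finset.mem_filter, Finset.mem_univ, true_and] at hb hmin
    exact h ⟨(m, b), hm, hb, (hmin w hc).trans_lt hw, fun w' hw' => not_lt.2 (hmin w' hw')⟩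
  · rw [hm] at hw
    exact hs.upward _ _ _ (hs.proposed_wife _ _ hm) hw

lemma galeShapley_spec (rule : ProposalRule M W) (P : Profile M W) :
    IsStable P (galeShapley rule P) ∧ ∀ ν, NearlyStable P ν → ∀ m,
      P.men m ((galeShapley rule P).wife m) ≤ P.men m (ν.wife m) := by
  obtain ⟨s, h1, hs, h3, h4⟩ := gsRun_spec rule P ⟨Matching.empty M W, ∅⟩
    ⟨by simp [Matching.empty], by simp, by simp, by simp [Matching.empty], by simp⟩
  rw [galeShapley, ← h1]
  have hmen : ∀ m, P.men m (s.matching.wife m) ≤ P.men m none := by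
    intro m
    rcases hm : s.matching.wife m with _ | w
    · exact le_rfl
    · exact (hs.acceptable _ _ (hs.proposed_wife _ _ hm)).le
  constructor
  · rw [isStable_iff]
    refine ⟨hmen, fun w t ht => ?_⟩
    rcases t with _ | m
    · exact hs.husband_le_none w
    · exact hs.husband_le _ _ (proposed_of_not_canPropose hs h4 (ht m rfl))
  · intro ν hν m
    by_contra! hc
    rcases hm : ν.wife m with _ | w
    · rw [hm] at hc; exact absurd hc (not_lt.2 (hmen m))
    · rw [hm] at hc
      have := h3 ν hν (by intro m w h; simp at h) m w (proposed_of_not_canPropose hs h4 hc) hm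
      rw [this] at hc
      exact lt_irrefl _ hc

lemma galeShapley_isStable (rule : ProposalRule M W) (P : Profile M W) :
    IsStable P (galeShapley rule P) := (galeShapley_spec rule P).1

lemma IsStable.nearlyStable {P : Profile M W} {ν : Matching M W} (h : IsStable P ν) :
    NearlyStable P ν := fun w t ht => Or.inr (((isStable_iff P ν).1 h).2 w t ht)

lemma galeShapley_le (rule : ProposalRule M W) {P : Profile M W} {ν : Matching M W}
    (h : NearlyStable P ν) (m : M) :
    P.men m ((galeShapley rule P).wife m) ≤ P.men m (ν.wife m) := (galeShapley_spec rule P).2 ν h m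

/-! ### Opposition of interests and the rural hospitals theorem -/

/-- Opposition of interests. -/
lemma IsStable.husband_le_of_wife_le {P : Profile M W} {μ ν : Matching M W} (hν : IsStable P ν)
    (h : ∀ m, P.men m (μ.wife m) ≤ P.men m (ν.wife m)) (w : W) :
    P.women w (ν.husband w) ≤ P.women w (μ.husband w) := by
  by_cases heq : ν.husband w = μ.husband w
  · rw [heq]
  refine ((isStable_iff P ν).1 hν).2 w _ fun m hm => ?_
  have h1 := (μ.wife_eq_iff _ _).2 hm
  refine lt_of_le_of_ne (h1 ▸ h m) fun h2 => heq ?_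
  rw [hm, ← ν.wife_eq_iff]
  exact ((P.men m).injective h2).symm

lemma Matching.card_matched (μ : Matching M W) :
    (Finset.univ.filter fun m => μ.wife m ≠ none).card =
      (Finset.univ.filter fun w => μ.husband w ≠ none).card := by
  classical
  have h1 : ((Finset.univ.filter fun m => μ.wife m ≠ none).map Function.Embedding.some) =
      (Finset.univ.filter fun w => μ.husband w ≠ none).image μ.husband := by
    ext x
    simp only [Finset.mem_map, Finset.mem_filter, Finset.mem_univ, true_and, Finset.mem_image,
      Option.ne_none_iff_exists', Function.Embedding.some_apply]
    constructor
    · rintro ⟨m, ⟨w, hw⟩, rfl⟩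
      exact ⟨w, ⟨m, (μ.wife_eq_iff _ _).1 hw⟩, (μ.wife_eq_iff _ _).1 hw⟩
    · rintro ⟨w, ⟨m, hm⟩, rfl⟩
      exact ⟨m, ⟨w, (μ.wife_eq_iff _ _).2 hm⟩, hm.symm⟩
  rw [← Finset.card_map Function.Embedding.some, h1, Finset.card_image_of_injOn]
  intro w hw w' hw' h
  simp only [Finset.coe_filter, Finset.mem_univ, true_and, Set.mem_ofPred_eq] at hw
  obtain ⟨m, hm⟩ := Option.ne_none_iff_exists'.1 hw
  have h2 := (μ.wife_eq_iff _ _).2 hm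
  have h3 := (μ.wife_eq_iff _ _).2 (h.symm.trans hm)
  exact Option.some.inj (h2.symm.trans h3)

lemma exists_proposalRule (M W : Type*) [Fintype M] [Fintype W] : Nonempty (ProposalRule M W) :=
  ⟨fun _ _ h => ⟨h.choose, h.choose_spec⟩⟩

/-- Every man matched in ν is matched in μ, and by opposition of interests every woman matched in μ
is matched in ν. Each matching has as many matched men as women, so both inclusions are equalities.
-/
lemma rural_aux {P : Profile M W} {μ ν : Matching M W} (hμ : IsStable P μ) (hν : IsStable P ν)
    (h : ∀ m, P.men m (μ.wife m) ≤ P.men m (ν.wife m)) :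
    (∀ m, ν.wife m = none ↔ μ.wife m = none) ∧ ∀ w, ν.husband w = none ↔ μ.husband w = none := by
  classical
  have hA : (Finset.univ.filter fun m => ν.wife m ≠ none) ⊆
      Finset.univ.filter fun m => μ.wife m ≠ none := by
    intro m
    simp only [Finset.mem_filter, Finset.mem_univ, true_and]
    refine mt fun hm => (P.men m).injective (le_antisymm (((isStable_iff P ν).1 hν).1 m) ?_)
    exact hm ▸ h m
  have hB : (Finset.univ.filter fun w => μ.husband w ≠ none) ⊆
      Finset.univ.filter fun w => ν.husband w ≠ none := by
    intro w
    simp only [Finset.mem_filter, Finset.mem_univ, true_and]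
    refine mt fun hw => (P.women w).injective
      (le_antisymm (((isStable_iff P μ).1 hμ).2 w none (by intro m hm; cases hm)) ?_)
    exact hw ▸ hν.husband_le_of_wife_le h w
  have hA' := Finset.eq_of_subset_of_card_le hA
    (by rw [Matching.card_matched, Matching.card_matched]; exact Finset.card_le_card hB)
  have hB' := Finset.eq_of_subset_of_card_le hB
    (by rw [← Matching.card_matched, ← Matching.card_matched]; exact Finset.card_le_card hA)
  constructor
  · intro m
    have := Finset.ext_iff.1 hA' m
    simpa [not_iff_not] using this
  · intro w
    have := Finset.ext_iff.1 hB' w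
    simp only [Finset.mem_filter, Finset.mem_univ, true_and, Ne, not_iff_not] at this
    exact this.symm

/-- The same agents are matched in all stable matchings. -/
lemma IsStable.rural {P : Profile M W} {μ ν : Matching M W} (hμ : IsStable P μ)
    (hν : IsStable P ν) :
    (∀ m, ν.wife m = none ↔ μ.wife m = none) ∧ ∀ w, ν.husband w = none ↔ μ.husband w = none := by
  obtain ⟨rule⟩ := exists_proposalRule M W
  have h1 := rural_aux (galeShapley_isStable rule P) hμ (galeShapley_le rule hμ.nearlyStable)
  have h2 := rural_aux (galeShapley_isStable rule P) hν (galeShapley_le rule hν.nearlyStable)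
  exact ⟨fun m => (h2.1 m).trans (h1.1 m).symm, fun w => (h2.2 w).trans (h1.2 w).symm⟩

/-! ### Preference lists: inversions, adjacent swaps, truncations -/

section Lists

variable {α : Type*} [Fintype α]

lemma exists_prefList_of_injective {β : Type*} [LinearOrder β] (f : α → β)
    (hf : Function.Injective f) : ∃ q : PrefList α, ∀ x y, q x < q y ↔ f x < f y := by
  let _ : LinearOrder α := LinearOrder.lift' f hf
  refine ⟨(monoEquivOfFin α rfl).symm.toEquiv, fun x y => ?_⟩
  exact (monoEquivOfFin α rfl).symm.lt_iff_lt

lemma exists_rankBy (key : α → ℕ) (p : PrefList α) :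
    ∃ q : PrefList α, ∀ x y, q x < q y ↔ key x < key y ∨ key x = key y ∧ p x < p y := by
  obtain ⟨q, hq⟩ := exists_prefList_of_injective (fun x => toLex (key x, p x)) (by
    intro x y h
    have := congrArg ofLex h
    simp only [ofLex_toLex, Prod.mk.injEq] at this
    exact p.injective this.2)
  exact ⟨q, fun x y => by rw [hq, Prod.Lex.toLex_lt_toLex]⟩

/-- The list that ranks by `key` first and by `p` among alternatives with equal keys. -/
noncomputable def rankBy (key : α → ℕ) (p : PrefList α) : PrefList α := (exists_rankBy key p).choose

lemma rankBy_lt (key : α → ℕ) (p : PrefList α) (x y : α) :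
    rankBy key p x < rankBy key p y ↔ key x < key y ∨ key x = key y ∧ p x < p y :=
  (exists_rankBy key p).choose_spec x y

lemma kendallTau_self (p : PrefList α) : kendallTau p p = 0 := by
  simp only [kendallTau, Finset.card_eq_zero, Finset.filter_eq_empty_iff]
  exact fun x _ h => lt_asymm h.1 h.2

/-- Without inversions, `p.symm.trans s` is an order automorphism of a finite chain, hence the
identity. -/
lemma exists_inversion_of_ne {p s : PrefList α} (h : p ≠ s) : ∃ x y, p x < p y ∧ s y < s x := by
  by_contra! hc
  refine h ?_
  have hmono : StrictMono (p.symm.trans s) := by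
    intro i j hij
    refine lt_of_le_of_ne (hc _ _ (by simpa using hij)) ?_
    simpa using hij.ne
  have hmono' : ∀ i j, (p.symm.trans s) i ≤ (p.symm.trans s) j ↔ i ≤ j := fun i j => hmono.le_iff_le
  have key : (⟨p.symm.trans s, fun {i j} => hmono' i j⟩ : Fin (Fintype.card α) ≃o Fin (Fintype.card α)) =
    OrderIso.refl _ := Subsingleton.elim _ _
  ext x
  have := congrArg (fun e => e (p x)) key
  simp only [RelIso.coe_fn_mk, Equiv.trans_apply, Equiv.symm_apply_apply, OrderIso.refl_apply]
    at this
  rw [this]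

/-- Take `y` to be the last entry before `o` in `p` that `s` ranks below `o`; its successor `x` is
then `o` or better than `o` for `s`. The threshold `o` between the two entries is what later
comparisons with an outcome use. -/
lemma exists_adjacent_inversion {p s : PrefList α} {z o : α} (hp : p z < p o) (hs : s o < s z) :
    ∃ y x, (p y : ℕ) + 1 = p x ∧ p x ≤ p o ∧ s o < s y ∧ s x ≤ s o := by
  classical
  obtain ⟨y, hy, hmax⟩ := Finset.exists_max_image
    (Finset.univ.filter fun y => p y < p o ∧ s o < s y) p ⟨z, by simp [hp, hs]⟩
  simp only [Finset.mem_filter, Finset.mem_univ, true_and] at hy hmax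
  have hlt : (p y : ℕ) + 1 < Fintype.card α := by have := hy.1; omega
  have hx : p (p.symm ⟨p y + 1, hlt⟩) = ⟨p y + 1, hlt⟩ := p.apply_symm_apply _
  refine ⟨y, p.symm ⟨p y + 1, hlt⟩, by rw [hx], by rw [hx, Fin.le_def]; exact hy.1, hy.2, ?_⟩
  by_contra! hc
  by_cases ho : p.symm ⟨p y + 1, hlt⟩ = o
  · rw [ho] at hc; exact lt_irrefl _ hc
  · have h1 : p (p.symm ⟨p y + 1, hlt⟩) ≠ p o := fun h => ho (p.injective h)
    have h2 := hmax _ ⟨lt_of_le_of_ne (by rw [hx, Fin.le_def]; exact hy.1) h1, hc⟩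
    rw [hx, Fin.le_def] at h2
    simp at h2

lemma lt_of_swapEntries_lt {p : PrefList α} {y x : α} (h : (p y : ℕ) + 1 = p x) {u v : α}
    (huv : ¬ (u = x ∧ v = y)) (hlt : swapEntries p y x u < swapEntries p y x v) : p u < p v := by
  have hu := fun a b => (p.injective.eq_iff (a := a) (b := b))
  simp only [Fin.ext_iff] at hu
  simp only [swapEntries, Equiv.trans_apply, Equiv.swap_apply_def, Fin.lt_def] at hlt ⊢
  have h1 := hu u y
  have h2 := hu u x
  have h3 := hu v y
  have h4 := hu v x
  grind

lemma swapEntries_lt_of_lt {p : PrefList α} {y x : α} (h : (p y : ℕ) + 1 = p x) {u v : α}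
    (huv : ¬ (u = y ∧ v = x)) (hlt : p u < p v) : swapEntries p y x u < swapEntries p y x v := by
  rcases lt_trichotomy (swapEntries p y x u) (swapEntries p y x v) with h1 | h1 | h1
  · exact h1
  · rw [(swapEntries p y x).injective h1] at hlt
    exact absurd hlt (lt_irrefl _)
  · exact absurd hlt (lt_asymm (lt_of_swapEntries_lt h (by tauto) h1))

lemma kendallTau_swapEntries_lt {p s : PrefList α} {y x : α} (h : (p y : ℕ) + 1 = p x)
    (hs : s x < s y) : kendallTau (swapEntries p y x) s < kendallTau p s := by
  refine Finset.card_lt_card (Finset.ssubset_iff_of_subset ?_ |>.2 ⟨(y, x), ?_, ?_⟩)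
  · rintro ⟨u, v⟩ huv
    simp only [Finset.mem_filter, Finset.mem_univ, true_and] at huv ⊢
    refine ⟨lt_of_swapEntries_lt h ?_ huv.1, huv.2⟩
    rintro ⟨rfl, rfl⟩
    exact lt_asymm hs huv.2
  · simp only [Finset.mem_filter, Finset.mem_univ, true_and]
    exact ⟨by rw [Prefers, Fin.lt_def]; omega, hs⟩
  · simp only [Finset.mem_filter, Finset.mem_univ, true_and, not_and]
    intro h1
    simp only [Prefers, swapEntries, Equiv.trans_apply, Equiv.swap_apply_left,
      Equiv.swap_apply_right, Fin.lt_def] at h1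
    omega

open Classical in
/-- The list that ranks `t` first and being unmatched second. -/
noncomputable def onlyList {β : Type*} [Fintype β] (s : PrefList (Option β)) (t : Option β) :
    PrefList (Option β) :=
  rankBy (fun x => if x = t then 0 else if x = none then 1 else 2) s

open Classical in
/-- The list `s` in which being unmatched is moved to the position just below `t`. -/
noncomputable def truncate {β : Type*} [Fintype β] (s : PrefList (Option β)) (t : Option β) :
    PrefList (Option β) :=
  rankBy (fun x => if s x ≤ s t then 0 else if x = none then 1 else 2) s

variable {β : Type*} [Fintype β] (s : PrefList (Option β)) (t : Option β)

lemma onlyList_self_le (x : Option β) : onlyList s t t ≤ onlyList s t x := by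
  by_contra! h
  rw [onlyList, rankBy_lt] at h
  by_cases hx : x = t
  · subst hx; simp at h
  · simp only [if_neg hx, if_true, not_lt_zero] at h
    split_ifs at h <;> simp at h

lemma eq_of_onlyList_lt_none {x : Option β} (h : onlyList s t x < onlyList s t none) : x = t := by
  by_contra hx
  by_cases h2 : x = none
  · rw [h2] at h; exact lt_irrefl _ h
  rw [onlyList, rankBy_lt] at h
  simp only [hx, h2, if_false] at h
  split_ifs at h <;> simp at h

variable {s t}

lemma le_of_truncate_lt_none {x : Option β} (h : truncate s t x < truncate s t none) :
    s x ≤ s t := by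
  by_contra hx
  by_cases h2 : x = none
  · rw [h2] at h; exact lt_irrefl _ h
  rw [truncate, rankBy_lt] at h
  simp only [hx, h2, if_false] at h
  split_ifs at h <;> simp at h

lemma truncate_lt_none (ht : s t < s none) {x : Option β} (h : s x ≤ s t) :
    truncate s t x < truncate s t none := by
  rw [truncate, rankBy_lt]
  simp [h, not_le.2 ht]

lemma truncate_lt_iff {x y : Option β} (h : s x ≤ s t) :
    truncate s t y < truncate s t x ↔ s y < s x := by
  rw [truncate, rankBy_lt]
  by_cases hy : s y ≤ s t
  · simp [h, hy]
  · have : ¬ s y < s x := fun h' => hy (h'.le.trans h)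
    simp [h, hy, this]

end Lists

/-! ### Stability when one agent changes her list -/

lemma updateWoman_self (P : Profile M W) (w : W) : P.updateWoman w (P.women w) = P := by
  simp [Profile.updateWoman]

lemma updateMan_self (P : Profile M W) (m : M) : P.updateMan m (P.men m) = P := by
  simp [Profile.updateMan]

lemma updateWoman_updateWoman (P : Profile M W) (w : W) (p q : PrefList (Option M)) :
    (P.updateWoman w p).updateWoman w q = P.updateWoman w q := by
  simp [Profile.updateWoman]

lemma updateMan_updateMan (P : Profile M W) (m : M) (p q : PrefList (Option W)) :
    (P.updateMan m p).updateMan m q = P.updateMan m q := by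
  simp [Profile.updateMan]

@[simp] lemma updateWoman_men (P : Profile M W) (w : W) (p : PrefList (Option M)) :
    (P.updateWoman w p).men = P.men := rfl

@[simp] lemma updateWoman_women_self (P : Profile M W) (w : W) (p : PrefList (Option M)) :
    (P.updateWoman w p).women w = p := by simp [Profile.updateWoman]

lemma updateWoman_women_of_ne (P : Profile M W) {w w' : W} (h : w' ≠ w) (p : PrefList (Option M)) :
    (P.updateWoman w p).women w' = P.women w' := by simp [Profile.updateWoman, h]

@[simp] lemma updateMan_men_self (P : Profile M W) (m : M) (p : PrefList (Option W)) :
    (P.updateMan m p).men m = p := by simp [Profile.updateMan]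

/-- Interchange of the roles of men and women. -/
def Profile.swap (P : Profile M W) : Profile W M := ⟨P.women, P.men⟩

/-- Interchange of the roles of men and women. -/
def Matching.swap {M W : Type*} (μ : Matching M W) : Matching W M :=
  ⟨μ.husband, μ.wife, fun w m => (μ.wife_eq_iff m w).symm⟩

lemma IsStable.swap {P : Profile M W} {μ : Matching M W} (h : IsStable P μ) :
    IsStable P.swap μ.swap := ⟨h.1.symm, fun w m hb => h.2 m w hb.symm⟩

lemma IsStable.husband_le_none {P : Profile M W} {μ : Matching M W} (h : IsStable P μ) (w : W) :
    P.women w (μ.husband w) ≤ P.women w none := (prefers_or_eq_iff _ _ _).1 (h.1.2 w)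

lemma IsStable.wife_le_none {P : Profile M W} {μ : Matching M W} (h : IsStable P μ) (m : M) :
    P.men m (μ.wife m) ≤ P.men m none := (prefers_or_eq_iff _ _ _).1 (h.1.1 m)

lemma IsStable.le_of_wants {P : Profile M W} {μ : Matching M W} (h : IsStable P μ) {w : W}
    {t : Option M} (ht : Wants P μ w t) : P.women w (μ.husband w) ≤ P.women w t :=
  ((isStable_iff P μ).1 h).2 w t ht

lemma IsStable.updateWoman {P : Profile M W} {μ : Matching M W} (h : IsStable P μ) {w : W}
    {q : PrefList (Option M)} (hq : ∀ t, Wants P μ w t → q (μ.husband w) ≤ q t) :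
    IsStable (P.updateWoman w q) μ := by
  rw [isStable_iff]
  refine ⟨h.wife_le_none, fun w' t ht => ?_⟩
  by_cases hw : w' = w
  · subst hw
    rw [updateWoman_women_self]
    exact hq t ht
  · rw [updateWoman_women_of_ne _ hw]
    exact h.le_of_wants ht

/-- Stability sees a woman's list only through the alternatives ranked above her partner, and
shrinking that set cannot create a block. -/
lemma IsStable.updateWoman_of_imp {P : Profile M W} {μ : Matching M W} {w : W}
    {p q : PrefList (Option M)} (h : IsStable (P.updateWoman w p) μ)
    (hq : ∀ t, q t < q (μ.husband w) → p t < p (μ.husband w)) :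
    IsStable (P.updateWoman w q) μ := by
  rw [← updateWoman_updateWoman P w p q]
  refine h.updateWoman fun t ht => ?_
  have := h.le_of_wants ht
  rw [updateWoman_women_self] at this
  exact not_lt.1 fun hlt => absurd (hq t hlt) (not_lt.2 this)

lemma IsStable.updateWoman_onlyList {P : Profile M W} {ν : Matching M W} {w : W}
    {p s : PrefList (Option M)} (h : IsStable (P.updateWoman w p) ν) :
    IsStable (P.updateWoman w (onlyList s (ν.husband w))) ν :=
  h.updateWoman_of_imp fun _ ht => absurd ht (not_lt.2 (onlyList_self_le _ _ _))

/-- If some report of `w` makes her partner `t` achievable, then so does truncation at `t`. -/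
lemma IsStable.le_of_truncate {P : Profile M W} {ν lam : Matching M W} {w : W}
    {p s : PrefList (Option M)} (hν : IsStable (P.updateWoman w p) ν)
    (hs : s (ν.husband w) < s none)
    (hl : IsStable (P.updateWoman w (truncate s (ν.husband w))) lam) :
    s (lam.husband w) ≤ s (ν.husband w) := by
  have h1 := hl.husband_le_none w
  rw [updateWoman_women_self] at h1
  rcases h1.lt_or_eq with h1 | h1
  · exact le_of_truncate_lt_none h1
  exfalso
  have h0 := (truncate s (ν.husband w)).injective h1
  -- If `w` were single in `lam`, then `lam` would stay stable when she accepts only her ν-partner.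
  -- But ν is stable for that report too and matches her, against `IsStable.rural`.
  have hl' : IsStable (P.updateWoman w (onlyList s (ν.husband w))) lam := by
    refine hl.updateWoman_of_imp fun t ht => ?_
    rw [h0] at ht ⊢
    rw [eq_of_onlyList_lt_none _ _ ht]
    exact truncate_lt_none hs le_rfl
  have := ((hν.updateWoman_onlyList (s := s)).rural hl').2 w
  rw [this.1 h0] at hs
  exact lt_irrefl _ hs

lemma IsStable.of_truncate {P : Profile M W} {lam : Matching M W} {w : W} {t : Option M}
    {s : PrefList (Option M)} (hl : IsStable (P.updateWoman w (truncate s t)) lam)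
    (hle : s (lam.husband w) ≤ s t) : IsStable (P.updateWoman w s) lam :=
  hl.updateWoman_of_imp fun _ hx => (truncate_lt_iff hle).2 hx

/-! ### Incentives under the algorithm -/

/-- No man gains from misreporting. -/
theorem galeShapley_strategyproof (rule : ProposalRule M W) (P : Profile M W) (m : M)
    (p : PrefList (Option W)) :
    P.men m ((galeShapley rule P).wife m) ≤
      P.men m ((galeShapley rule (P.updateMan m p)).wife m) := by
  by_contra! h
  set ν := galeShapley rule (P.updateMan m p) with hν
  -- With the roles interchanged, the truncation lemmas apply to `m`: truncating at the coveted
  -- partner yields a matching stable for `P` that he likes better than the man-optimal one.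
  have hν' : IsStable (P.swap.updateWoman m p) ν.swap :=
    (galeShapley_isStable rule (P.updateMan m p)).swap
  have hl : IsStable (P.swap.updateWoman m (truncate (P.men m) (ν.wife m)))
      (galeShapley rule (P.updateMan m (truncate (P.men m) (ν.wife m)))).swap :=
    (galeShapley_isStable rule (P.updateMan m (truncate (P.men m) (ν.wife m)))).swap
  have h1 := hν'.le_of_truncate
    (h.trans_le ((galeShapley_isStable rule P).wife_le_none m)) hl
  have h2 := hl.of_truncate h1
  have h3 : P.swap.updateWoman m (P.men m) = P.swap := updateWoman_self P.swap m
  rw [h3] at h2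
  have h4 := galeShapley_le rule h2.swap.nearlyStable m
  exact absurd (h4.trans h1) (not_le.2 h)

lemma galeShapley_eq_of_le (rule : ProposalRule M W) {P : Profile M W} {ν : Matching M W}
    (hν : IsStable P ν) (h : ∀ m, P.men m (ν.wife m) ≤ P.men m ((galeShapley rule P).wife m)) :
    ν = galeShapley rule P :=
  Matching.ext_wife fun m => (P.men m).injective
    (le_antisymm (h m) (galeShapley_le rule hν.nearlyStable m))

/-- An adjacent swap in a woman's list changes the outcome only if it changes her partner between
the two swapped entries. -/
lemma galeShapley_swapEntries (rule : ProposalRule M W) (P : Profile M W) (w : W) {y x : Option M}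
    (hadj : (P.women w y : ℕ) + 1 = P.women w x)
    (hx : (galeShapley rule (P.updateWoman w (swapEntries (P.women w) y x))).husband w ≠ x)
    (hy : (galeShapley rule P).husband w ≠ y) :
    galeShapley rule (P.updateWoman w (swapEntries (P.women w) y x)) = galeShapley rule P := by
  set Q := P.updateWoman w (swapEntries (P.women w) y x) with hQ
  -- The swap reverses only the pair `y`, `x`, so each outcome is stable for the other profile as
  -- well; man-optimality on both sides makes them equal.
  have h1 : IsStable P (galeShapley rule Q) := by
    rw [← updateWoman_self P w]
    exact (galeShapley_isStable rule Q).updateWoman_of_imp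
      fun t ht => swapEntries_lt_of_lt hadj (fun h => hx h.2) ht
  have h2 : IsStable Q (galeShapley rule P) := by
    have := galeShapley_isStable rule P
    nth_rw 1 [← updateWoman_self P w] at this
    exact this.updateWoman_of_imp fun t ht => lt_of_swapEntries_lt hadj (fun h => hy h.2) ht
  exact galeShapley_eq_of_le rule h1 fun m => galeShapley_le rule h2.nearlyStable m

/-- A woman can obtain every man who prefers her to his partner. -/
lemma exists_report_of_prefers (rule : ProposalRule M W) (P : Profile M W) {m : M} {w : W}
    (h : Prefers (P.men m) (some w) ((galeShapley rule P).wife m)) :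
    ∃ p, (galeShapley rule (P.updateWoman w p)).husband w = some m := by
  refine ⟨onlyList (P.women w) (some m), ?_⟩
  set Q := P.updateWoman w (onlyList (P.women w) (some m)) with hQ
  have hst := galeShapley_isStable rule Q
  rcases (hst.husband_le_none w).lt_or_eq with h1 | h1
  · rw [hQ, updateWoman_women_self] at h1
    exact eq_of_onlyList_lt_none _ _ h1
  exfalso
  have h0 := (Q.women w).injective h1
  -- If `w` stays single, only she can block this outcome under `P`. Hence every man does at least
  -- as well under `P`, so `m` still prefers `w` to his partner under `Q` and blocks there.
  have hn : NearlyStable P (galeShapley rule Q) := by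
    intro w' t ht
    by_cases hw : w' = w
    · exact Or.inl (hw ▸ h0)
    · right
      have := hst.le_of_wants (w := w') ht
      rwa [hQ, updateWoman_women_of_ne _ hw] at this
  have h2 := hst.le_of_wants (w := w) (t := some m) (by
    rintro m' ⟨⟩
    exact h.trans_le (galeShapley_le rule hn m))
  rw [h0, hQ, updateWoman_women_self] at h2
  have h4 := (onlyList (P.women w) (some m)).injective
    (le_antisymm h2 (onlyList_self_le (P.women w) (some m) none))
  cases h4

/-- The women-proposing version of the algorithm provides the matching. -/
lemma exists_woman_best (S : Profile M W) :
    ∃ ω, IsStable S ω ∧ ∀ ν, IsStable S ν → ∀ w,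
      S.women w (ω.husband w) ≤ S.women w (ν.husband w) := by
  obtain ⟨rule⟩ := exists_proposalRule W M
  exact ⟨(galeShapley rule S.swap).swap, (galeShapley_isStable rule S.swap).swap,
    fun ν hν w => galeShapley_le rule hν.swap.nearlyStable w⟩

/-! ### Locally minimally dishonest equilibria -/

/-- A locally minimally dishonest man is honest. -/
lemma men_eq_of_locallyMinDishonest (rule : ProposalRule M W) {S P : Profile M W} {m : M}
    (h : ManLocallyMinDishonest (galeShapley rule) S P m) : P.men m = S.men m := by
  by_contra hne
  obtain ⟨z, o, hp, hs⟩ := exists_inversion_of_ne hne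
  obtain ⟨y, x, hadj, -, h1, h2⟩ := exists_adjacent_inversion hp hs
  have hxy := h2.trans_lt h1
  have hmin := h y x (kendallTau_swapEntries_lt hadj hxy)
  -- Strategyproofness in both directions: if the swap changes his partner, it is from `y` to `x`,
  -- which is a sincere improvement.
  have e1 := galeShapley_strategyproof rule P m (swapEntries (P.men m) y x)
  have e2 := galeShapley_strategyproof rule (P.updateMan m (swapEntries (P.men m) y x)) m (P.men m)
  rw [updateMan_updateMan, updateMan_self, updateMan_men_self] at e2
  set μ := galeShapley rule P
  set ν := galeShapley rule (P.updateMan m (swapEntries (P.men m) y x))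
  have hne' : ν.wife m ≠ μ.wife m := fun h' => by
    rw [h'] at hmin
    exact lt_irrefl _ hmin
  have e3 := lt_of_le_of_ne e2 fun h' => hne' ((swapEntries (P.men m) y x).injective h')
  by_cases hc : ν.wife m = x ∧ μ.wife m = y
  · rw [hc.1, hc.2] at hmin
    exact lt_asymm hmin hxy
  · exact absurd e1 (not_le.2 (lt_of_swapEntries_lt hadj hc e3))

section Equilibrium

variable {rule : ProposalRule M W} {S P : Profile M W}

/-- With honest men, equilibrium outcomes are stable for the sincere profile. -/
lemma isStable_of_women_nash (hmen : P.men = S.men)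
    (hN : ∀ w p, ¬ Prefers (S.women w) ((galeShapley rule (P.updateWoman w p)).husband w)
      ((galeShapley rule P).husband w)) : IsStable S (galeShapley rule P) := by
  have hst := galeShapley_isStable rule P
  rw [isStable_iff]
  refine ⟨fun m => by rw [← hmen]; exact hst.wife_le_none m, fun w t ht => ?_⟩
  rcases t with _ | m
  · have h1 := hN w (onlyList (P.women w) none)
    have h2 := (galeShapley_isStable rule
      (P.updateWoman w (onlyList (P.women w) none))).husband_le_none w
    rw [updateWoman_women_self] at h2
    rw [(onlyList (P.women w) none).injective (le_antisymm h2 (onlyList_self_le _ _ _))] at h1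
    exact not_lt.1 h1
  · have h0 : Prefers (P.men m) (some w) ((galeShapley rule P).wife m) := by
      rw [hmen]; exact ht m rfl
    obtain ⟨p, hp⟩ := exists_report_of_prefers rule P h0
    exact not_lt.1 (hp ▸ hN w p)

variable {w : W}

/-- Otherwise some adjacent inversion straddles the sincere rank of her partner. Undoing it either
gives her `x`, which is no worse than her partner, or changes nothing; both contradict minimality.
-/
lemma le_of_prefers_outcome (h : WomanLocallyMinDishonest (galeShapley rule) S P w) {z : Option M}
    (hz : P.women w z < P.women w ((galeShapley rule P).husband w)) :
    S.women w z ≤ S.women w ((galeShapley rule P).husband w) := by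
  by_contra! hc
  obtain ⟨y, x, hadj, -, h1, h2⟩ := exists_adjacent_inversion hz hc
  have hmin := h y x (kendallTau_swapEntries_lt hadj (h2.trans_lt h1))
  rw [galeShapley_swapEntries rule P w hadj] at hmin
  · exact lt_irrefl _ hmin
  · intro h'
    rw [h'] at hmin
    exact absurd hmin (not_lt.2 h2)
  · intro h'
    rw [h'] at h1
    exact lt_irrefl _ h1

/-- The delicate case is that her partner is `y`. The outcome after the swap is then stable for `P`,
so her submitted list ranks it at least as high as the man-optimal outcome, and
`le_of_prefers_outcome` makes it sincerely no worse. -/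
lemma no_adjacent_inversion (h : WomanLocallyMinDishonest (galeShapley rule) S P w)
    {y x : Option M} (hadj : (P.women w y : ℕ) + 1 = P.women w x)
    (hxy : S.women w x < S.women w y)
    (hx : S.women w x ≤ S.women w ((galeShapley rule P).husband w)) : False := by
  have hmin := h y x (kendallTau_swapEntries_lt hadj hxy)
  set Q := P.updateWoman w (swapEntries (P.women w) y x) with hQ
  have hne : (galeShapley rule Q).husband w ≠ x := by
    intro h'
    rw [h'] at hmin
    exact absurd hmin (not_lt.2 hx)
  by_cases hy : (galeShapley rule P).husband w = y
  · have h1 : IsStable P (galeShapley rule Q) := by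
      rw [← updateWoman_self P w]
      exact (galeShapley_isStable rule Q).updateWoman_of_imp
        fun t ht => swapEntries_lt_of_lt hadj (fun h => hne h.2) ht
    have h2 := h1.husband_le_of_wife_le (fun m => galeShapley_le rule h1.nearlyStable m) w
    rcases h2.lt_or_eq with h2 | h2
    · exact absurd (le_of_prefers_outcome h h2) (not_le.2 hmin)
    · rw [(P.women w).injective h2] at hmin
      exact lt_irrefl _ hmin
  · rw [galeShapley_swapEntries rule P w hadj hne hy] at hmin
    exact lt_irrefl _ hmin

lemma isWomanOptimal_of_isLocallyMinDishonestEq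
    (h : IsLocallyMinDishonestEq (galeShapley rule) S P) :
    IsWomanOptimal S (galeShapley rule P) ∧ ∀ m, P.men m = S.men m := by
  have hmen' : ∀ m, P.men m = S.men m := fun m => men_eq_of_locallyMinDishonest rule (h.2.1 m)
  refine ⟨?_, hmen'⟩
  have hmen : P.men = S.men := funext hmen'
  have hst := isStable_of_women_nash hmen h.1.2
  obtain ⟨ω, hω, hbest⟩ := exists_woman_best S
  have key : ∀ w, S.women w ((galeShapley rule P).husband w) ≤ S.women w (ω.husband w) := by
    intro w
    by_contra! hlt
    have hQ : IsStable (P.updateWoman w (onlyList (P.women w) (ω.husband w))) ω := by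
      rw [isStable_iff]
      refine ⟨fun m => by rw [updateWoman_men, hmen]; exact hω.wife_le_none m, fun w' t ht => ?_⟩
      by_cases hw : w' = w
      · subst hw
        rw [updateWoman_women_self]
        exact onlyList_self_le _ _ _
      · rw [updateWoman_women_of_ne _ hw]
        by_contra! hc
        have ht' : Wants S ω w' t := by
          intro m hm
          rw [← hmen]
          exact ht m hm
        have h1 := lt_of_le_of_ne (hω.le_of_wants ht') fun h' => by
          rw [(S.women w').injective h'] at hc
          exact lt_irrefl _ hc
        -- A block of ω under the submitted lists would be an inversion around `ω.husband w'`, which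
        -- is sincerely at least as good as her outcome since that outcome is stable.
        obtain ⟨y, x, hadj, -, h2, h3⟩ := exists_adjacent_inversion hc h1
        exact no_adjacent_inversion (h.2.2 w') hadj (h3.trans_lt h2)
          (h3.trans (hbest _ hst w'))
    have hr := galeShapley_isStable rule
      (P.updateWoman w (onlyList (P.women w) (ω.husband w)))
    have h1 := hr.husband_le_none w
    rw [updateWoman_women_self] at h1
    have hN := h.1.2 w (onlyList (P.women w) (ω.husband w))
    rcases h1.lt_or_eq with h1 | h1
    · rw [eq_of_onlyList_lt_none _ _ h1] at hN
      exact hN hlt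
    · have h2 := ((hr.rural hQ).2 w).2
        ((onlyList (P.women w) (ω.husband w)).injective h1)
      rw [h2] at hlt
      exact absurd hlt (not_lt.2 (hst.husband_le_none w))
  exact ⟨hst, fun ν hν w => not_lt.2 ((key w).trans (hbest ν hν w))⟩

end Equilibrium

/-! ### Existence of a minimally dishonest equilibrium -/

/-- `p` starts with the alternatives that `s` ranks at least as high as `a`, in the order of
`s`. -/
def AgreesAbove {α : Type*} [Fintype α] (p s : PrefList α) (a : α) : Prop :=
  ∀ x y, s x ≤ s a → (p y < p x ↔ s y < s x)

lemma AgreesAbove.le_of_le {α : Type*} [Fintype α] {p s : PrefList α} {a x : α}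
    (h : AgreesAbove p s a) (hx : p x ≤ p a) : s x ≤ s a := by
  rcases hx.lt_or_eq with hx | hx
  · exact ((h a x le_rfl).1 hx).le
  · rw [p.injective hx]

open Classical in
/-- The list `p` with the alternatives that `s` ranks at least as high as `a` moved to the top and
sorted by `s`. -/
noncomputable def raiseAbove {α : Type*} [Fintype α] (p s : PrefList α) (a : α) : PrefList α :=
  rankBy (fun x => if s x ≤ s a then (s x : ℕ) else Fintype.card α) p

lemma agreesAbove_raiseAbove {α : Type*} [Fintype α] (p s : PrefList α) (a : α) :
    AgreesAbove (raiseAbove p s a) s a := by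
  intro x y hx
  rw [raiseAbove, rankBy_lt]
  by_cases hy : s y ≤ s a
  · simp only [hx, hy, if_true, ← Fin.ext_iff, ← Fin.lt_def, s.injective.eq_iff]
    constructor
    · rintro (h | ⟨rfl, h⟩)
      · exact h
      · exact absurd h (lt_irrefl _)
    · exact Or.inl
  · have h1 : ¬ s y < s x := fun h => hy (h.le.trans hx)
    -- The key `Fintype.card α` of the remaining alternatives exceeds every position.
    have h2 := (s x).isLt
    simp only [hx, hy, if_true, if_false, h1, iff_false, not_or, not_and]
    exact ⟨by omega, by omega⟩

lemma raiseAbove_lt_iff {α : Type*} [Fintype α] (p s : PrefList α) {a x y : α}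
    (hx : s a < s x) (hy : s a < s y) : raiseAbove p s a y < raiseAbove p s a x ↔ p y < p x := by
  rw [raiseAbove, rankBy_lt]
  simp [not_le.2 hx, not_le.2 hy]

lemma raiseAbove_lt {α : Type*} [Fintype α] (p s : PrefList α) {a x y : α}
    (hx : s a < s x) (hy : s y ≤ s a) : raiseAbove p s a y < raiseAbove p s a x := by
  rw [raiseAbove, rankBy_lt]
  simp [not_le.2 hx, hy]

/-- The raised block is sorted by `s` and sits on top, so an inversion that survives lies below it,
where the order is that of `p`. -/
lemma kendallTau_raiseAbove_le {α : Type*} [Fintype α] (p s : PrefList α) (a : α) :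
    kendallTau (raiseAbove p s a) s ≤ kendallTau p s := by
  refine Finset.card_le_card ?_
  rintro ⟨u, v⟩ huv
  simp only [Finset.mem_filter, Finset.mem_univ, true_and] at huv ⊢
  refine ⟨?_, huv.2⟩
  rcases le_or_gt (s v) (s a) with hv | hv
  · exact absurd ((agreesAbove_raiseAbove p s a v u hv).1 huv.1) (lt_asymm huv.2)
  · exact (raiseAbove_lt_iff p s hv (hv.trans huv.2)).1 huv.1

section Existence

variable {rule : ProposalRule M W} {S P : Profile M W} {ω : Matching M W}

/-- Men are honest, the outcome is `ω`, and every woman is honest about the men that she ranks at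
least as high as her partner in `ω`. -/
structure SupportsOutcome (rule : ProposalRule M W) (S : Profile M W) (ω : Matching M W)
    (P : Profile M W) : Prop where
  men : P.men = S.men
  outcome : galeShapley rule P = ω
  women : ∀ w, AgreesAbove (P.women w) (S.women w) (ω.husband w)

/-- A profitable deviation of `w` can be taken to be a truncation, whose outcome is stable for `P`.
Since ω is woman-worst for `P`, every woman gets there at least her ω-partner, in the range where
her list is honest; so the outcome is sincerely stable and beats ω for `w`. -/
lemma SupportsOutcome.isNash (hbest : ∀ ν, IsStable S ν → ∀ w,
      S.women w (ω.husband w) ≤ S.women w (ν.husband w)) (hω : IsStable S ω)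
    (h : SupportsOutcome rule S ω P) : IsNash (galeShapley rule) S P := by
  refine ⟨fun m p => ?_, fun w p hlt => ?_⟩
  · rw [← h.men]
    exact not_lt.2 (galeShapley_strategyproof rule P m p)
  · rw [h.outcome] at hlt
    have hν := galeShapley_isStable rule (P.updateWoman w p)
    set ν := galeShapley rule (P.updateWoman w p)
    have hl := galeShapley_isStable rule
      (P.updateWoman w (truncate (S.women w) (ν.husband w)))
    set lam := galeShapley rule (P.updateWoman w (truncate (S.women w) (ν.husband w)))
    have h1 := hν.le_of_truncate (hlt.trans_le (hω.husband_le_none w)) hl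
    have h2 : IsStable P lam := by
      rw [← updateWoman_self P w]
      exact (hl.of_truncate h1).updateWoman_of_imp
        fun t ht => (h.women w _ _ (h1.trans hlt.le)).1 ht
    have h3 := h2.husband_le_of_wife_le fun m => galeShapley_le rule h2.nearlyStable m
    rw [h.outcome] at h3
    have h4 : IsStable S lam := by
      rw [isStable_iff]
      refine ⟨fun m => by rw [← h.men]; exact h2.wife_le_none m, fun w' t ht => ?_⟩
      have ht' : Wants P lam w' t := by
        intro m hm
        rw [h.men]
        exact ht m hm
      by_contra! hc
      exact absurd (h2.le_of_wants ht')
        (not_le.2 ((h.women w' _ _ ((h.women w').le_of_le (h3 w'))).2 hc))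
    exact absurd ((hbest _ h4 w).trans h1) (not_le.2 hlt)

/-- Truncating all women at ω keeps ω stable and lets no matched woman fall below it, while the
algorithm's outcome is woman-worst and matches the same women. -/
lemma exists_supportsOutcome (rule : ProposalRule M W) (hω : IsStable S ω) :
    ∃ P, SupportsOutcome rule S ω P := by
  have hagree : ∀ w, AgreesAbove (truncate (S.women w) (ω.husband w)) (S.women w) (ω.husband w) :=
    fun w x y hx => truncate_lt_iff hx
  refine ⟨⟨S.men, fun w => truncate (S.women w) (ω.husband w)⟩, rfl, ?_, hagree⟩
  set P : Profile M W := ⟨S.men, fun w => truncate (S.women w) (ω.husband w)⟩ with hP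
  have hst : IsStable P ω := by
    rw [isStable_iff]
    refine ⟨hω.wife_le_none, fun w t ht => ?_⟩
    by_contra! hc
    exact absurd (hω.le_of_wants (t := t) (w := w) ht) (not_le.2 ((hagree w _ _ le_rfl).1 hc))
  have hr := galeShapley_isStable rule P
  have hop := hst.husband_le_of_wife_le fun m => galeShapley_le rule hst.nearlyStable m
  refine Matching.ext_husband fun w => ?_
  rcases (hr.husband_le_none w).lt_or_eq with h | h
  · refine (S.women w).injective (le_antisymm (le_of_truncate_lt_none h) ?_)
    by_contra! hc
    exact absurd (hop w) (not_le.2 ((hagree w _ _ le_rfl).2 hc))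
  · have h' := (P.women w).injective h
    rw [h', ((hr.rural hst).2 w).2 h']

/-- A report of `w` that is as good for her as `ω` can be replaced by one that is honest about the
men she ranks at least as high as her partner in `ω`. -/
lemma SupportsOutcome.raiseAbove (hbest : ∀ ν, IsStable S ν → ∀ w,
      S.women w (ω.husband w) ≤ S.women w (ν.husband w)) (hω : IsStable S ω)
    (h : SupportsOutcome rule S ω P) {w : W} {p : PrefList (Option M)}
    (hp : (galeShapley rule (P.updateWoman w p)).husband w = ω.husband w) :
    SupportsOutcome rule S ω
      (P.updateWoman w (raiseAbove p (S.women w) (ω.husband w))) := by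
  have hN := h.isNash hbest hω
  have hag := agreesAbove_raiseAbove p (S.women w) (ω.husband w)
  set q := StableMatching.raiseAbove p (S.women w) (ω.husband w) with hq
  refine ⟨h.men, ?_, fun w' => ?_⟩
  · have hPst : IsStable P ω := h.outcome ▸ galeShapley_isStable rule P
    have hν := galeShapley_isStable rule (P.updateWoman w p)
    have hκ := galeShapley_isStable rule (P.updateWoman w q)
    have hωle : IsStable (P.updateWoman w q) ω := by
      refine hPst.updateWoman fun t ht => ?_
      by_contra! hc
      exact absurd (hPst.le_of_wants ht)
        (not_le.2 ((h.women w _ _ le_rfl).2 ((hag _ _ le_rfl).1 hc)))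
    have h1 : ∀ m, P.men m ((galeShapley rule (P.updateWoman w q)).wife m) ≤
      P.men m (ω.wife m) := fun m => galeShapley_le rule hωle.nearlyStable m
    -- A block with `w` would involve a man whom she could obtain by some report and sincerely
    -- prefers to her ω-partner, against Nash.
    have hνP : IsStable P (galeShapley rule (P.updateWoman w p)) := by
      suffices hs : IsStable ((P.updateWoman w p).updateWoman w (P.women w))
          (galeShapley rule (P.updateWoman w p)) by
        rwa [updateWoman_updateWoman, updateWoman_self] at hs
      refine hν.updateWoman fun t ht => ?_
      rw [hp]
      by_contra! hc
      have hlt := (h.women w _ _ le_rfl).1 hc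
      rcases t with _ | m
      · exact absurd hlt (not_lt.2 (hω.husband_le_none w))
      · obtain ⟨p', hp'⟩ := exists_report_of_prefers rule _ (ht m rfl)
        rw [updateWoman_updateWoman] at hp'
        have := hN.2 w p'
        rw [hp', h.outcome] at this
        exact this hlt
    have h2 : ∀ m, P.men m (ω.wife m) ≤
        P.men m ((galeShapley rule (P.updateWoman w p)).wife m) := fun m => by
      have := galeShapley_le rule hνP.nearlyStable m
      rwa [h.outcome] at this
    have h3 : ∀ m, P.men m (ω.wife m) ≤
        P.men m ((galeShapley rule (P.updateWoman w q)).wife m) := by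
      intro m
      -- If her new partner lies in the raised block, the outcome is stable for `P`; if below, it is
      -- stable for the report `p`. In both cases man-optimality bounds it by ω.
      rcases le_or_gt (S.women w ((galeShapley rule (P.updateWoman w q)).husband w))
        (S.women w (ω.husband w)) with hc | hc
      · have hκP : IsStable P (galeShapley rule (P.updateWoman w q)) := by
          have := hκ.updateWoman_of_imp (q := P.women w)
            fun t ht => (hag _ _ hc).2 ((h.women w _ _ hc).1 ht)
          rwa [updateWoman_self] at this
        have := galeShapley_le rule hκP.nearlyStable m
        rwa [h.outcome] at this
      · have hκP : IsStable (P.updateWoman w p) (galeShapley rule (P.updateWoman w q)) := by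
          refine hκ.updateWoman_of_imp fun t ht => ?_
          rcases le_or_gt (S.women w t) (S.women w (ω.husband w)) with ht' | ht'
          · exact raiseAbove_lt _ _ hc ht'
          · exact (raiseAbove_lt_iff _ _ hc ht').2 ht
        exact (h2 m).trans (galeShapley_le rule hκP.nearlyStable m)
    exact Matching.ext_wife fun m => (P.men m).injective (le_antisymm (h1 m) (h3 m))
  · by_cases hw : w' = w
    · subst hw
      rwa [updateWoman_women_self]
    · rw [updateWoman_women_of_ne _ hw]
      exact h.women w'

lemma exists_isMinDishonestEq (rule : ProposalRule M W) (S : Profile M W) :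
    ∃ P, IsMinDishonestEq (galeShapley rule) S P := by
  obtain ⟨ω, hω, hbest⟩ := exists_woman_best S
  -- Least total dishonesty of the women; improving one woman's report lowers the sum.
  obtain ⟨P, hP, hmin⟩ := (measure fun P : Profile M W =>
    ∑ w, kendallTau (P.women w) (S.women w)).wf.has_min {P | SupportsOutcome rule S ω P}
    (exists_supportsOutcome rule hω)
  have hP' : SupportsOutcome rule S ω P := hP
  have hN := hP'.isNash hbest hω
  refine ⟨P, hN, fun m p hp => ?_, fun w p hp => ?_⟩
  · rw [hP'.men, kendallTau_self] at hp
    exact absurd hp (Nat.not_lt_zero _)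
  · rw [hP'.outcome]
    by_contra hc
    have h1 := hN.2 w p
    rw [hP'.outcome] at h1
    have h2 := (S.women w).injective (le_antisymm (not_lt.1 hc) (not_lt.1 h1))
    refine hmin _ (hP'.raiseAbove hbest hω h2) ?_
    change ∑ w', kendallTau ((P.updateWoman w _).women w') (S.women w') <
      ∑ w', kendallTau (P.women w') (S.women w')
    refine Finset.sum_lt_sum (fun w' _ => ?_) ⟨w, Finset.mem_univ _, ?_⟩
    · by_cases hw : w' = w
      · subst hw
        rw [updateWoman_women_self]
        exact (kendallTau_raiseAbove_le _ _ _).trans hp.le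
      · rw [updateWoman_women_of_ne _ hw]
    · rw [updateWoman_women_self]
      exact (kendallTau_raiseAbove_le _ _ _).trans_lt hp

end Existence

lemma IsMinDishonestEq.isLocallyMinDishonestEq {r : Profile M W → Matching M W} {S P : Profile M W}
    (h : IsMinDishonestEq r S P) : IsLocallyMinDishonestEq r S P :=
  ⟨h.1, fun m _ _ hk => h.2.1 m _ hk, fun w _ _ hk => h.2.2 w _ hk⟩

end StableMatching

theorem theorem4 {M W : Type*} [Fintype M] [Fintype W]
    (rule : StableMatching.ProposalRule M W) (S : StableMatching.Profile M W) :
    (∃ P, StableMatching.IsMinDishonestEq (StableMatching.galeShapley rule) S P) ∧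
    (∃ P, StableMatching.IsLocallyMinDishonestEq (StableMatching.galeShapley rule) S P) ∧
    (∀ P, StableMatching.IsMinDishonestEq (StableMatching.galeShapley rule) S P →
      StableMatching.IsWomanOptimal S (StableMatching.galeShapley rule P) ∧
        ∀ m, P.men m = S.men m) ∧
    (∀ P, StableMatching.IsLocallyMinDishonestEq (StableMatching.galeShapley rule) S P →
      StableMatching.IsWomanOptimal S (StableMatching.galeShapley rule P) ∧
        ∀ m, P.men m = S.men m) := by
  obtain ⟨P, hP⟩ := StableMatching.exists_isMinDishonestEq rule S
  exact ⟨⟨P, hP⟩, ⟨P, hP.isLocallyMinDishonestEq⟩,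
    fun Q hQ => StableMatching.isWomanOptimal_of_isLocallyMinDishonestEq
      hQ.isLocallyMinDishonestEq,
    fun Q hQ => StableMatching.isWomanOptimal_of_isLocallyMinDishonestEq hQ⟩
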